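/- For a simple graph $G$, let $\operatorname{M}(G)$ be the graph on the same vertex set in which $x$ and $y$ are adjacent if and only if their distance $d_G(x,y)$ in $G$ is exactly $2$. Put $\operatorname{M}^0(G)=G$ and $\operatorname{M}^{k+1}(G)=\operatorname{M}(\operatorname{M}^k(G))$ for $k\in\mathbb{N}$. The metamour limit period of $G$ is the least $p\ge 1$ such that $\operatorname{M}^{p+i}(G)=\operatorname{M}^i(G)$ for all sufficiently large $i$, and the metamour limit set of $G$ is the set of graphs that occur in the sequence $(\operatorname{M}^i(G))_{i}$ for arbitrarily large $i$. Equality means equality as graphs on the same labelled vertex set. Theorem. Let $m\ge 2$ and $h\ge 5$ be integers, and let $T=T(h,m)$ be the complete $m$-ary tree with $h$ levels below the root. Then, for $k\in\mathbb{N}$, $$\operatorname{M}^k(T)=\operatorname{M}^{k+2}(T)\quad\text{if and only if}\quad k\ge\lceil\log_2 h\rceil .$$ Moreover, $T$ has metamour limit period $2$, and for every $k\ge\lceil\log_2 h\rceil$ the metamour limit set of $T$ is $\{\operatorname{M}^k(T),\operatorname{M}^{k+1}(T)\}$, with edges given as follows. Let $x,y$ be distinct vertices of $T$, and exclude the case where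 $x$ and $y$ both have depth $1$ (distance $1$ from the root), $m=2$ and $h\in\{5,6\}$. Then $$xy\in E(\operatorname{M}^k(T))\iff d_{\operatorname{M}^2(T)}(x,y)<\infty\ \text{ and }\ \left\lceil\log_2 d_{\operatorname{M}^2(T)}(x,y)\right\rceil\equiv k\pmod 2 .$$ In the excluded case, $xy$ is not an edge of $\operatorname{M}^k(T)$ for any $k\ge\lceil\log_2 h\rceil$. -/

import Mathlib

/-- The metamour graph (2-distance graph) `M(G)`: same vertices, with `x` and `y` adjacent
if and only if their distance in `G` is exactly `2`. The distance `edist` takes values in `ℕ∞`. -/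
def metamour {V : Type*} (G : SimpleGraph V) : SimpleGraph V where
  Adj x y := G.edist x y = 2
  symm := ⟨fun x y h => by rw [SimpleGraph.edist_comm]; exact h⟩
  loopless := ⟨fun x h => by simp at h⟩

/-- The iterates of the metamour operation: `M⁰(G) = G` and `Mᵏ⁺¹(G) = M(Mᵏ(G))`. -/
def metamourIter {V : Type*} (G : SimpleGraph V) : ℕ → SimpleGraph V
  | 0 => G
  | k + 1 => metamour (metamourIter G k)

/-- `p` is the metamour limit period of `G`: the least positive `p` such that
`Mᵖ⁺ⁱ(G) = Mⁱ(G)` for all sufficiently large `i`. -/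
def IsMetamourLimitPeriod {V : Type*} (G : SimpleGraph V) (p : ℕ) : Prop :=
  IsLeast {q : ℕ | 0 < q ∧ ∃ N : ℕ, ∀ i : ℕ, N ≤ i →
    metamourIter G (q + i) = metamourIter G i} p

/-- The metamour limit set of `G`: the graphs that occur in the sequence `Mⁱ(G)` for arbitrarily
large `i`. When the sequence is periodic from index `N` on, this is `{Mⁱ(G) | i ≥ N}`. -/
def metamourLimitSet {V : Type*} (G : SimpleGraph V) : Set (SimpleGraph V) :=
  {H | ∀ N : ℕ, ∃ i : ℕ, N ≤ i ∧ metamourIter G i = H}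

/-- The vertices of the complete `m`-ary tree of height `h`: words of length at most `h` over an
alphabet of `m` letters. The empty word is the root, and the children of `w` are the words
`a :: w`, as long as the length of `w` is less than `h`. -/
abbrev TreeVertex (h m : ℕ) : Type := {w : List (Fin m) // w.length ≤ h}

/-- The complete `m`-ary tree `T(h, m)` of height `h`: two vertices are adjacent if and only if
one of them is a child of the other. -/
def completeTree (h m : ℕ) : SimpleGraph (TreeVertex h m) where
  Adj x y := (∃ a : Fin m, y.1 = a :: x.1) ∨ (∃ a : Fin m, x.1 = a :: y.1)
  symm := ⟨fun _ _ hxy => hxy.symm⟩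
  loopless := ⟨fun x hx => by
    rcases hx with ⟨a, ha⟩ | ⟨a, ha⟩ <;> simpa using congrArg List.length ha⟩

/-- The root of the complete `m`-ary tree. -/
def treeRoot (h m : ℕ) : TreeVertex h m := ⟨[], Nat.zero_le h⟩

/-- The depth of a vertex is its distance from the root. -/
noncomputable def treeDepth {h m : ℕ} (x : TreeVertex h m) : ℕ∞ :=
  (completeTree h m).edist (treeRoot h m) x

/-- The exceptional pairs: two vertices of depth `1`, when `m = 2` and `h = 5` or `h = 6`. -/
def IsExceptionalPair {h m : ℕ} (x y : TreeVertex h m) : Prop :=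
  treeDepth x = 1 ∧ treeDepth y = 1 ∧ m = 2 ∧ (h = 5 ∨ h = 6)

/-! A tree is bipartite, so $M^2(T)$ joins exactly the pairs at tree distance 4. Write $G$ for this
graph and $d$ for its distance. Iterating $M$ doubles the scale: apart from exceptional pairs, $xy$
is an edge of $M^j(G)$ iff $0 < d \le 2^j$ and $\lceil\log_2 d\rceil \equiv j$ mod 2
(`metamourIter_adj_iff`). The induction cuts a geodesic of length at least 4 into two pieces whose
lengths both have the required parity of $\lceil\log_2\rceil$. This fails for $d = 1$, and for $d =
3 = 1 + 2$, where the pieces have opposite parities; such pairs need a vertex at distance 2 from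
both ends.

For $m \ge 2$ and $h \ge 5$ the tree branches enough to supply these vertices
(`exists_twoSteps_of_four`, `exists_edist_eq_two_of_edist_eq_three`), except for the two children of
the root when $m = 2$ and $h \in \{5, 6\}$. There, every other vertex at finite distance is at
distance 1 from one of them and 2 from the other, so the two are never joined.

Finite distances in $G$ are at most $\lceil h/2\rceil$ (`edist_le_of_even`), attained by leaves in
different branches at the root. Distances in $(2^j, 2^{j+1}]$ have the wrong parity for $j$, so the
bound $d \le 2^j$ is void once $\lceil h/2\rceil \le 2^{j+1}$; with $k = j + 2$ this says $h \le
2^k$. -/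

/-! ### Iterated metamour graphs and binary scales of distance -/

theorem metamour_adj_iff {V : Type*} {G : SimpleGraph V} {x y : V} :
    (metamour G).Adj x y ↔ x ≠ y ∧ ¬ G.Adj x y ∧ ∃ z, G.Adj x z ∧ G.Adj z y :=
  SimpleGraph.edist_eq_two_iff.trans ⟨fun ⟨h1, h2, z, hz⟩ => ⟨h1, h2, z, hz.1, hz.2.symm⟩,
    fun ⟨h1, h2, z, hz⟩ => ⟨h1, h2, z, hz.1, hz.2.symm⟩⟩

theorem eq_of_edist_eq_natCast_zero {V : Type*} {G : SimpleGraph V} {x y : V}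
    (h : G.edist x y = ((0 : ℕ) : ℕ∞)) : x = y :=
  SimpleGraph.edist_eq_zero_iff.1 (by rw [h]; rfl)

/-- Cut a shortest walk after `i` steps: the pieces bound both distances from above, and the
triangle inequality leaves no slack. -/
theorem exists_edist_split {V : Type*} {G : SimpleGraph V} {x y : V} {i j : ℕ}
    (h : G.edist x y = ((i + j : ℕ) : ℕ∞)) : ∃ z, G.edist x z = i ∧ G.edist z y = j := by
  obtain ⟨p, hp⟩ := SimpleGraph.exists_walk_of_edist_ne_top (G := G) (u := x) (v := y)
    (by rw [h]; exact ENat.natCast_ne_top _)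
  rw [h] at hp
  have hp2 : p.length = i + j := by exact_mod_cast hp
  have h1 : G.edist x (p.getVert i) ≤ i := by
    refine (SimpleGraph.Walk.edist_le (p.take i)).trans ?_
    rw [SimpleGraph.Walk.take_length]
    exact_mod_cast min_le_left _ _
  have h2 : G.edist (p.getVert i) y ≤ j := by
    refine (SimpleGraph.Walk.edist_le (p.drop i)).trans ?_
    rw [SimpleGraph.Walk.drop_length, hp2]
    exact_mod_cast (by omega : i + j - i ≤ j)
  have h3 := SimpleGraph.edist_triangle (G := G) (u := x) (v := p.getVert i) (w := y)
  rw [h] at h3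
  obtain ⟨a, ha⟩ := ENat.ne_top_iff_exists.1 (ne_top_of_le_ne_top (ENat.natCast_ne_top _) h1)
  obtain ⟨b, hb⟩ := ENat.ne_top_iff_exists.1 (ne_top_of_le_ne_top (ENat.natCast_ne_top _) h2)
  refine ⟨p.getVert i, ?_⟩
  rw [← ha] at h1 h3 ⊢
  rw [← hb] at h2 h3 ⊢
  norm_cast at h1 h2 h3 ⊢
  omega

theorem clog_two_eq_succ_iff {n i : ℕ} : Nat.clog 2 n = i + 1 ↔ 2 ^ i < n ∧ n ≤ 2 ^ (i + 1) := by
  rw [← Nat.clog_le_iff_le_pow one_lt_two, ← Nat.lt_clog_iff_pow_lt one_lt_two]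
  omega

theorem clog_two_eq_succ {n : ℕ} (i : ℕ) (h1 : 2 ^ i < n) (h2 : n ≤ 2 ^ (i + 1)) :
    Nat.clog 2 n = i + 1 :=
  clog_two_eq_succ_iff.2 ⟨h1, h2⟩

/-- A distance above `3` splits into two distances in the class of the preceding scale. -/
theorem exists_split_clog {n i : ℕ} (hn : 4 ≤ n) (hi : Nat.clog 2 n = i + 1) :
    ∃ a b, n = a + b ∧ a ≠ 0 ∧ b ≠ 0 ∧ a ≤ 2 ^ i ∧ b ≤ 2 ^ i ∧
      Nat.clog 2 a ≡ i [MOD 2] ∧ Nat.clog 2 b ≡ i [MOD 2] := by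
  obtain ⟨h1, h2⟩ := clog_two_eq_succ_iff.1 hi
  obtain _ | i := i
  · omega
  have c1 : Nat.clog 2 1 = 0 := by simp
  have c2 : Nat.clog 2 2 = 0 + 1 := clog_two_eq_succ 0 (by norm_num) (by norm_num)
  obtain _ | i := i
  · have : n = 4 := by norm_num at h2; omega
    exact ⟨2, 2, by omega, by omega, by omega, by norm_num, by norm_num, by rw [c2],
      by rw [c2]⟩
  have hp : 2 ^ (i + 1) = 2 * 2 ^ i := by ring
  have hp2 : 2 ^ (i + 1 + 1) = 4 * 2 ^ i := by ring
  have hp3 : 2 ^ (i + 1 + 1 + 1) = 8 * 2 ^ i := by ring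
  have hpos : 0 < 2 ^ i := by positivity
  -- Halving works unless the smaller half drops to $2^{i+1}$, of the wrong parity. In that one case
  -- a piece of length 1 or 2 is split off, according to the parity of `i`.
  rcases eq_or_ne n (2 ^ (i + 1 + 1) + 1) with h | h
  · rcases Nat.even_or_odd i with he | ho
    · refine ⟨2 ^ (i + 1 + 1), 1, h, by omega, by omega, le_rfl, by omega, ?_, ?_⟩
      · rw [Nat.clog_pow _ _ one_lt_two]
      · rw [c1]; obtain ⟨r, rfl⟩ := he; unfold Nat.ModEq; omega
    · refine ⟨2 ^ (i + 1 + 1) - 1, 2, by omega, by omega, by omega, by omega, by omega, ?_, ?_⟩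
      · rw [clog_two_eq_succ (i + 1) (by omega) (by omega)]
      · rw [c2]; obtain ⟨r, rfl⟩ := ho; unfold Nat.ModEq; omega
  · refine ⟨n / 2, n - n / 2, by omega, by omega, by omega, by omega, by omega, ?_, ?_⟩
    · rw [clog_two_eq_succ (i + 1) (by omega) (by omega)]
    · rw [clog_two_eq_succ (i + 1) (by omega) (by omega)]

/-- A closed form for the iterated metamour graphs of a graph in which all pairs at distance `1`
or `3` have a common vertex at distance `2`, apart from a set of exceptional pairs. -/
theorem metamourIter_adj_iff {V : Type*} {G : SimpleGraph V} (Exc : V → V → Prop)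
    (h1 : ∀ x y, G.edist x y = 1 → ∃ z, G.edist x z = 2 ∧ G.edist z y = 2)
    (h3 : ∀ x y, G.edist x y = 3 → ¬ Exc x y → ∃ z, G.edist x z = 2 ∧ G.edist z y = 2)
    (he1 : ∀ x y, Exc x y → G.edist x y ≠ 1)
    (he2 : ∀ x y, Exc x y → G.edist x y ≠ 2)
    (hed : ∀ x y, Exc x y → ∀ u v, ∀ n : ℕ, G.edist u v = n → n ≤ 3)
    (hez : ∀ x y, Exc x y → ∀ z, ∀ a b : ℕ, G.edist x z = a → G.edist z y = b → a ≠ 0 → b ≠ 0 →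
      ¬ Nat.clog 2 a ≡ Nat.clog 2 b [MOD 2]) (j : ℕ) (x y : V) :
    (metamourIter G j).Adj x y ↔ ¬ Exc x y ∧ ∃ n : ℕ, G.edist x y = n ∧ n ≠ 0 ∧ n ≤ 2 ^ j ∧
      Nat.clog 2 n ≡ j [MOD 2] := by
  induction j generalizing x y with
  | zero =>
    change G.Adj x y ↔ _
    rw [← SimpleGraph.edist_eq_one_iff_adj]
    constructor
    · intro h
      exact ⟨fun he => he1 x y he h, 1, by simpa using h, one_ne_zero, by norm_num, by simp; rfl⟩
    · rintro ⟨-, n, hn, h0, hle, -⟩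
      have : n = 1 := by simp at hle; omega
      simpa [this] using hn
  | succ j ih =>
    change (metamour (metamourIter G j)).Adj x y ↔ _
    rw [metamour_adj_iff]
    simp only [ih]
    constructor
    · rintro ⟨hne, hna, z, ⟨hxz, a, ha, ha0, haj, hac⟩, ⟨hzy, b, hb, hb0, hbj, hbc⟩⟩
      have hexc : ¬ Exc x y := fun he => hez x y he z a b ha hb ha0 hb0 (hac.trans hbc.symm)
      refine ⟨hexc, ?_⟩
      have ht := SimpleGraph.edist_triangle (G := G) (u := x) (v := z) (w := y)
      rw [ha, hb] at ht
      obtain ⟨n, hn⟩ := ENat.ne_top_iff_exists.1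
        (ne_top_of_le_ne_top (by rw [← ENat.natCast_add]; exact ENat.natCast_ne_top _) ht)
      rw [← hn] at ht
      have ht' : n ≤ a + b := by exact_mod_cast ht
      have hn0 : n ≠ 0 := by
        rintro rfl
        exact hne (eq_of_edist_eq_natCast_zero hn.symm)
      have hnj : n ≤ 2 ^ (j + 1) := by rw [pow_succ]; omega
      refine ⟨n, hn.symm, hn0, hnj, ?_⟩
      -- Below $2^j$ the non-adjacency at stage `j` excludes the parity of `j`; above it the value
      -- of `Nat.clog` is forced to be `j + 1`.
      by_cases hj : n ≤ 2 ^ j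
      · have : ¬ Nat.clog 2 n ≡ j [MOD 2] := fun hc => hna ⟨hexc, n, hn.symm, hn0, hj, hc⟩
        unfold Nat.ModEq at this ⊢
        omega
      · rw [clog_two_eq_succ_iff.2 ⟨by omega, hnj⟩]
    · rintro ⟨hexc, n, hn, hn0, hnj, hnc⟩
      refine ⟨?_, ?_, ?_⟩
      · rintro rfl
        rw [SimpleGraph.edist_self] at hn
        exact hn0 (by exact_mod_cast hn.symm)
      · rintro ⟨-, n', hn', -, -, hc⟩
        rw [hn] at hn'
        have : n = n' := by exact_mod_cast hn'
        subst this
        unfold Nat.ModEq at *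
        omega
      have two : ∀ u v, G.edist u v = 2 → Odd j → ¬ Exc u v ∧ ∃ n : ℕ, G.edist u v = n ∧ n ≠ 0 ∧
          n ≤ 2 ^ j ∧ Nat.clog 2 n ≡ j [MOD 2] := by
        intro u v huv hj
        refine ⟨fun he => he2 u v he huv, 2, by simpa using huv, two_ne_zero, ?_, ?_⟩
        · exact le_self_pow₀ (by norm_num) (by rintro rfl; simp at hj)
        · rw [clog_two_eq_succ 0 (by norm_num) (by norm_num)]
          obtain ⟨r, rfl⟩ := hj
          unfold Nat.ModEq
          omega
      have hcases : n = 1 ∨ n = 2 ∨ n = 3 ∨ 4 ≤ n := by omega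
      rcases hcases with rfl | rfl | rfl | hn4
      · have hj : Odd j := by
          rw [Nat.odd_iff]; simp [Nat.ModEq] at hnc; omega
        obtain ⟨z, hz1, hz2⟩ := h1 x y (by simpa using hn)
        exact ⟨z, two _ _ hz1 hj, two _ _ hz2 hj⟩
      · obtain ⟨z, hz1, hz2⟩ := exists_edist_split (i := 1) (j := 1) hn
        have hj : Nat.clog 2 1 ≡ j [MOD 2] := by
          rw [clog_two_eq_succ 0 (by norm_num) (by norm_num)] at hnc
          simp [Nat.ModEq] at hnc ⊢
          omega
        exact ⟨z, ⟨fun he => he1 _ _ he (by simpa using hz1), 1, hz1, one_ne_zero,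
          Nat.one_le_two_pow, hj⟩, ⟨fun he => he1 _ _ he (by simpa using hz2), 1, hz2, one_ne_zero,
          Nat.one_le_two_pow, hj⟩⟩
      · have hj : Odd j := by
          rw [clog_two_eq_succ 1 (by norm_num) (by norm_num)] at hnc
          rw [Nat.odd_iff]; simp [Nat.ModEq] at hnc; omega
        obtain ⟨z, hz1, hz2⟩ := h3 x y (by simpa using hn) hexc
        exact ⟨z, two _ _ hz1 hj, two _ _ hz2 hj⟩
      -- By `hed`, exceptional pairs occur only if all finite distances are at most 3, so here the
      -- pieces of the geodesic cannot be exceptional.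
      · have hno : ∀ u v, ¬ Exc u v := fun u v he => by
          have := hed u v he x y n hn
          omega
        have hcl : 0 < Nat.clog 2 n := Nat.clog_pos one_lt_two (by omega)
        obtain ⟨i, hi⟩ : ∃ i, Nat.clog 2 n = i + 1 := ⟨Nat.clog 2 n - 1, by omega⟩
        obtain ⟨a, b, rfl, ha0, hb0, ha, hb, hac, hbc⟩ := exists_split_clog hn4 hi
        obtain ⟨z, hz1, hz2⟩ := exists_edist_split hn
        have hij : i ≤ j := by
          have := (Nat.clog_le_iff_le_pow one_lt_two).2 hnj
          omega
        have hle : 2 ^ i ≤ 2 ^ j := Nat.pow_le_pow_right two_pos hij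
        have hmod : i ≡ j [MOD 2] := by
          rw [hi] at hnc
          exact Nat.ModEq.add_right_cancel' 1 hnc
        exact ⟨z, ⟨hno _ _, a, hz1, ha0, ha.trans hle, hac.trans hmod⟩,
          ⟨hno _ _, b, hz2, hb0, hb.trans hle, hbc.trans hmod⟩⟩

/-! ### Distances between words, geodesics and branches -/

/-- The distance of two words in the tree of all words, in which the children of `w` are the
words `w ++ [a]`. -/
def wordDist {α : Type*} [DecidableEq α] : List α → List α → ℕ
  | [], q => q.length
  | a :: p, [] => (a :: p).length
  | a :: p, b :: q => if a = b then wordDist p q else p.length + q.length + 2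

section WordDist

variable {α : Type*} [DecidableEq α]

@[simp] theorem wordDist_nil_left (q : List α) : wordDist [] q = q.length := by
  simp [wordDist]

@[simp] theorem wordDist_nil_right (p : List α) : wordDist p [] = p.length := by
  cases p <;> simp [wordDist]

@[simp] theorem wordDist_cons_self (a : α) (p q : List α) :
    wordDist (a :: p) (a :: q) = wordDist p q := by
  simp [wordDist]

theorem wordDist_cons_of_ne {a b : α} (h : a ≠ b) (p q : List α) :
    wordDist (a :: p) (b :: q) = p.length + q.length + 2 := by
  simp [wordDist, h]

@[simp] theorem wordDist_append (w p q : List α) :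
    wordDist (w ++ p) (w ++ q) = wordDist p q := by
  induction w with
  | nil => rfl
  | cons a w ih => simpa using ih

@[simp] theorem wordDist_append_right (w p : List α) : wordDist w (w ++ p) = p.length := by
  simpa using wordDist_append w [] p

@[simp] theorem wordDist_append_left (w p : List α) : wordDist (w ++ p) w = p.length := by
  simpa using wordDist_append w p []

theorem wordDist_comm (p q : List α) : wordDist p q = wordDist q p := by
  induction p generalizing q with
  | nil => simp
  | cons a p ih =>
    cases q with
    | nil => simp
    | cons b q =>
      by_cases h : a = b
      · subst h; simpa using ih q
      · rw [wordDist_cons_of_ne h, wordDist_cons_of_ne (Ne.symm h)]; omega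

theorem wordDist_le (p q : List α) : wordDist p q ≤ p.length + q.length := by
  induction p generalizing q with
  | nil => simp
  | cons a p ih =>
    cases q with
    | nil => simp
    | cons b q =>
      by_cases h : a = b
      · subst h; have := ih q; simp; omega
      · rw [wordDist_cons_of_ne h]; simp; omega

theorem length_le_wordDist (p q : List α) : p.length ≤ wordDist p q + q.length := by
  induction p generalizing q with
  | nil => simp
  | cons a p ih =>
    cases q with
    | nil => simp
    | cons b q =>
      by_cases h : a = b
      · subst h; have := ih q; simp; omega
      · rw [wordDist_cons_of_ne h]; simp; omega

theorem wordDist_triangle (p q r : List α) : wordDist p r ≤ wordDist p q + wordDist q r := by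
  induction q generalizing p r with
  | nil => simpa using wordDist_le p r
  | cons b q ih =>
    rcases p with _ | ⟨a, p⟩
    · have := length_le_wordDist r (b :: q)
      rw [wordDist_comm r] at this
      simpa [add_comm] using this
    rcases r with _ | ⟨c, r⟩
    · simpa using length_le_wordDist (a :: p) (b :: q)
    have h1 := length_le_wordDist p q
    have h2 := length_le_wordDist r q
    rw [wordDist_comm] at h2
    have h3 := ih p r
    have h4 := wordDist_le p r
    simp only [wordDist]
    split_ifs <;> first | omega | simp_all

theorem wordDist_parity (p q : List α) : wordDist p q % 2 = (p.length + q.length) % 2 := by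
  induction p generalizing q with
  | nil => simp
  | cons a p ih =>
    cases q with
    | nil => simp
    | cons b q =>
      by_cases h : a = b
      · subst h; have := ih q; simp; omega
      · rw [wordDist_cons_of_ne h]; simp; omega

theorem wordDist_eq_zero_iff (p q : List α) : wordDist p q = 0 ↔ p = q := by
  induction p generalizing q with
  | nil => simp [eq_comm]
  | cons a p ih =>
    cases q with
    | nil => simp
    | cons b q =>
      by_cases h : a = b
      · subst h; simpa using ih q
      · rw [wordDist_cons_of_ne h]; simp [h]

/-- Any two words split off their longest common prefix. -/
theorem exists_append_of_wordDist (x y : List α) : ∃ w p q, x = w ++ p ∧ y = w ++ q ∧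
    wordDist x y = p.length + q.length ∧
    (p = [] ∨ q = [] ∨ ∃ a b p' q', a ≠ b ∧ p = a :: p' ∧ q = b :: q') := by
  induction x generalizing y with
  | nil => exact ⟨[], [], y, rfl, rfl, by simp, Or.inl rfl⟩
  | cons a x ih =>
    cases y with
    | nil => exact ⟨[], a :: x, [], rfl, rfl, by simp, Or.inr (Or.inl rfl)⟩
    | cons b y =>
      by_cases h : a = b
      · subst h
        obtain ⟨w, p, q, rfl, rfl, h1, h2⟩ := ih y
        exact ⟨a :: w, p, q, rfl, rfl, by simpa using h1, h2⟩
      · exact ⟨[], a :: x, b :: y, rfl, rfl, by rw [wordDist_cons_of_ne h]; simp; omega,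
          Or.inr (Or.inr ⟨a, b, x, y, h, rfl, rfl⟩)⟩

theorem wordDist_take_left {p q : List α} (h : wordDist p q = p.length + q.length) (k : ℕ) :
    wordDist (p.take k) q = (p.take k).length + q.length := by
  rcases p with _ | ⟨a, p⟩
  · simp
  rcases q with _ | ⟨b, q⟩
  · simp
  rcases k with _ | k
  · simp
  have hab : a ≠ b := by
    rintro rfl
    have := wordDist_le p q
    simp at h
    omega
  rw [List.take_succ_cons, wordDist_cons_of_ne hab]
  simp only [List.length_cons]
  omega

theorem wordDist_take_self (p : List α) (k : ℕ) : wordDist p (p.take k) = p.length - k := by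
  conv_lhs => rw [← List.take_append_drop k p, List.take_append_drop k p]
  have := wordDist_append_left (p.take k) (p.drop k)
  rw [List.take_append_drop] at this
  simpa using this

/-- The hypothesis `hi` says that the wanted vertex lies between `x` and the branching point, so it
is a prefix of `x` and respects the height bound. -/
theorem exists_wordDist_split_aux {x y : List α} {i j h : ℕ} (hx : x.length ≤ h)
    (hd : wordDist x y = i + j) (hi : i + y.length ≤ j + x.length) :
    ∃ z : List α, z.length ≤ h ∧ wordDist x z = i ∧ wordDist z y = j := by
  obtain ⟨w, p, q, rfl, rfl, h1, -⟩ := exists_append_of_wordDist x y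
  simp only [List.length_append] at hi hx
  rw [wordDist_append] at hd h1
  refine ⟨w ++ p.take (p.length - i), ?_, ?_, ?_⟩
  · simp; omega
  · rw [wordDist_append, wordDist_take_self]; omega
  · rw [wordDist_append, wordDist_take_left h1, List.length_take]; omega

theorem exists_wordDist_split {x y : List α} {i j h : ℕ} (hx : x.length ≤ h) (hy : y.length ≤ h)
    (hd : wordDist x y = i + j) :
    ∃ z : List α, z.length ≤ h ∧ wordDist x z = i ∧ wordDist z y = j := by
  rcases le_total (i + y.length) (j + x.length) with hi | hi
  · exact exists_wordDist_split_aux hx hd hi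
  · obtain ⟨z, h1, h2, h3⟩ := exists_wordDist_split_aux (x := y) (y := x) (i := j) (j := i) hy
      (by rw [wordDist_comm]; omega) hi
    exact ⟨z, h1, by rw [wordDist_comm]; exact h3, by rw [wordDist_comm]; exact h2⟩

/-- From outside the subtree of `c`, every path to a vertex of that subtree enters through `c`. -/
theorem wordDist_append_of_not_prefix {y c : List α} (h : ¬ c <+: y) (p : List α) :
    wordDist y (c ++ p) = wordDist y c + p.length := by
  induction c generalizing y with
  | nil => simp at h
  | cons a c ih =>
    rcases y with _ | ⟨b, y⟩
    · simp; omega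
    · by_cases hab : b = a
      · subst hab
        have : ¬ c <+: y := by simpa using h
        simpa using ih this
      · rw [List.cons_append, wordDist_cons_of_ne hab, wordDist_cons_of_ne hab]
        simp; omega

theorem wordDist_concat_of_not_prefix {y c : List α} {t : α} (h : ¬ c ++ [t] <+: y) :
    wordDist y (c ++ [t]) = wordDist y c + 1 := by
  induction c generalizing y with
  | nil =>
    rcases y with _ | ⟨b, y⟩
    · simp
    · have hb : b ≠ t := by
        rintro rfl
        simp at h
      rw [List.nil_append, wordDist_cons_of_ne hb]
      simp
  | cons a c ih =>
    rcases y with _ | ⟨b, y⟩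
    · simp
    · by_cases hab : b = a
      · subst hab
        have : ¬ c ++ [t] <+: y := by simpa using h
        simpa using ih this
      · rw [List.cons_append, wordDist_cons_of_ne hab, wordDist_cons_of_ne hab]
        simp; omega

theorem wordDist_cons_replicate {a b : α} (h : a ≠ b) (p : List α) (k : ℕ) :
    wordDist (a :: p) (List.replicate k b) = p.length + 1 + k := by
  cases k with
  | zero => simp
  | succ k => rw [List.replicate_succ, wordDist_cons_of_ne h]; simp; omega

variable [Nontrivial α]

/-- If `c` is not the root and lies between `x` and `y`, then a branch of any length that is at
most the distances of `c` from `x` and `y` leaves the path from `x` to `y` at `c`. -/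
theorem exists_branch {x y c : List α} {h l : ℕ} (hx : x.length ≤ h) (hy : y.length ≤ h)
    (hc : c ≠ []) (hd : wordDist x c + wordDist c y = wordDist x y) (hl : 1 ≤ l)
    (hlx : l ≤ wordDist x c) (hly : l ≤ wordDist c y) :
    ∃ z : List α, z.length ≤ h ∧ wordDist c z = l ∧ wordDist x z = wordDist x c + l ∧
      wordDist z y = l + wordDist c y := by
  obtain hc' | ⟨c', t, rfl⟩ := List.eq_nil_or_concat c
  · exact absurd hc' hc
  rw [List.concat_eq_append] at *
  -- If both ends lie below `c`, the branch goes up to the parent and down another child. If just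
  -- one does, it goes down from `c`, away from that end. If neither does, the parent of `c` is
  -- closer to both ends, so `c` is not on the path.
  by_cases hcx : c' ++ [t] <+: x <;> by_cases hcy : c' ++ [t] <+: y
  · obtain ⟨p, rfl⟩ := hcx
    obtain ⟨q, rfl⟩ := hcy
    rcases p with _ | ⟨a, p⟩
    · simp at hlx; omega
    rcases q with _ | ⟨b, q⟩
    · simp at hly; omega
    obtain ⟨t', ht⟩ := exists_ne t
    simp at hx hy hlx hly
    refine ⟨c' ++ List.replicate (l - 1) t', by simp; omega, ?_, ?_, ?_⟩
    · rw [wordDist_append, wordDist_cons_replicate ht.symm]; simp; omega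
    · rw [List.append_assoc, wordDist_append, List.singleton_append,
        wordDist_cons_replicate ht.symm, wordDist_append]
      simp; omega
    · rw [wordDist_comm, List.append_assoc, wordDist_append, List.singleton_append,
        wordDist_cons_replicate ht.symm, wordDist_append]
      simp; omega
  · obtain ⟨p, rfl⟩ := hcx
    rcases p with _ | ⟨a, p⟩
    · simp at hlx; omega
    obtain ⟨b, hb⟩ := exists_ne a
    simp at hx hlx
    refine ⟨c' ++ [t] ++ List.replicate l b, by simp; omega, by simp, ?_, ?_⟩
    · rw [wordDist_append, wordDist_cons_replicate hb.symm, wordDist_append_left]; simp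
    · rw [wordDist_comm, wordDist_append_of_not_prefix hcy, wordDist_comm]; simp; omega
  · obtain ⟨p, rfl⟩ := hcy
    rcases p with _ | ⟨a, p⟩
    · simp at hly; omega
    obtain ⟨b, hb⟩ := exists_ne a
    simp at hy hly
    refine ⟨c' ++ [t] ++ List.replicate l b, by simp; omega, by simp, ?_, ?_⟩
    · rw [wordDist_append_of_not_prefix hcx]; simp
    · rw [wordDist_append, wordDist_comm, wordDist_cons_replicate hb.symm, wordDist_append_right]
      simp; omega
  · exfalso
    have h1 := wordDist_concat_of_not_prefix hcx
    have h2 := wordDist_concat_of_not_prefix hcy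
    have h3 := wordDist_triangle x c' y
    rw [wordDist_comm y, wordDist_comm y] at h2
    omega

end WordDist

/-- Any word of length at least `2`. -/
theorem exists_eq_append_pair {α : Type*} {w : List α} (hw : 2 ≤ w.length) : ∃ w' s t, w = w' ++ [s, t] := by
  obtain rfl | ⟨w, t, rfl⟩ := List.eq_nil_or_concat w
  · simp at hw
  obtain rfl | ⟨w, s, rfl⟩ := List.eq_nil_or_concat w
  · simp at hw
  exact ⟨w, s, t, by simp⟩

/-! ### Steps of length four between words -/

section TwoSteps

variable {α : Type*} [DecidableEq α]

/-- `x` and `y` have distance `2` in the graph on the words of length at most `h` in which words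
at distance `4` are adjacent. -/
def TwoSteps (h : ℕ) (x y : List α) : Prop :=
  wordDist x y ≠ 0 ∧ wordDist x y ≠ 4 ∧
    ∃ z : List α, z.length ≤ h ∧ wordDist x z = 4 ∧ wordDist z y = 4

variable {h : ℕ}

theorem TwoSteps.symm {x y : List α} (hxy : TwoSteps h x y) : TwoSteps h y x := by
  obtain ⟨h0, h4, z, hz, h1, h2⟩ := hxy
  exact ⟨by rwa [wordDist_comm], by rwa [wordDist_comm], z, hz, by rwa [wordDist_comm],
    by rwa [wordDist_comm]⟩

theorem twoSteps_of_eight {x y : List α} (hx : x.length ≤ h) (hy : y.length ≤ h)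
    (hd : wordDist x y = 8) : TwoSteps h x y := by
  obtain ⟨z, hz⟩ := exists_wordDist_split (i := 4) (j := 4) hx hy hd
  exact ⟨by omega, by omega, z, hz⟩

/-- The middle vertex lies below a third child of the root. For two letters there is no such child,
which is the source of the exceptional pairs. -/
theorem twoSteps_top {a b c : α} (hab : a ≠ b) (hac : a ≠ c) (hbc : b ≠ c) (hh : 3 ≤ h) :
    TwoSteps h [a] [b] := by
  refine ⟨by simp [wordDist_cons_of_ne hab], by simp [wordDist_cons_of_ne hab], [c, c, c],
    by simpa using hh, ?_, ?_⟩
  · simp [wordDist_cons_of_ne hac]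
  · simp [wordDist_cons_of_ne hbc.symm]

/-- There is a chain of three steps of length `4` from `x` to `y`. -/
def ThreeSteps (h : ℕ) (x y : List α) : Prop :=
  ∃ z z' : List α, z.length ≤ h ∧ z'.length ≤ h ∧
    wordDist x z = 4 ∧ wordDist z z' = 4 ∧ wordDist z' y = 4

theorem ThreeSteps.symm {x y : List α} (hxy : ThreeSteps h x y) : ThreeSteps h y x := by
  obtain ⟨z, z', hz, hz', h1, h2, h3⟩ := hxy
  exact ⟨z', z, hz', hz, by rwa [wordDist_comm], by rwa [wordDist_comm], by rwa [wordDist_comm]⟩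

theorem TwoSteps.cons {x z y : List α} (hz : z.length ≤ h) (hxz : wordDist x z = 4)
    (hzy : TwoSteps h z y) : ThreeSteps h x y := by
  obtain ⟨-, -, z', hz', h1, h2⟩ := hzy
  exact ⟨z, z', hz, hz', hxz, h1, h2⟩

/-- The shapes of a pair of words at distance `2`. -/
theorem wordDist_eq_two_cases {x y : List α} (hd : wordDist x y = 2) :
    (∃ a b, y = x ++ [a, b]) ∨ (∃ a b, x = y ++ [a, b]) ∨
      ∃ w a b, a ≠ b ∧ x = w ++ [a] ∧ y = w ++ [b] := by
  obtain ⟨w, p, q, rfl, rfl, h1, rfl | rfl | ⟨a, b, p', q', hab, rfl, rfl⟩⟩ :=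
    exists_append_of_wordDist x y
  · match q, h1.symm.trans hd with
    | [a, b], _ => exact Or.inl ⟨a, b, by simp⟩
  · match p, h1.symm.trans hd with
    | [a, b], _ => exact Or.inr (Or.inl ⟨a, b, by simp⟩)
  · match p', q', h1.symm.trans hd with
    | [], [], _ => exact Or.inr (Or.inr ⟨w, a, b, hab, rfl, rfl⟩)
    | _ :: _, _, hl => simp at hl; omega
    | _, _ :: _, hl => simp at hl; omega

variable [Nontrivial α]

/-- An edge leaving the path at its midpoint `c` ends at distance 4 from both ends. The root must be
avoided, since for two letters it may have no third neighbour. -/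
theorem twoSteps_of_six {x y : List α} (c : List α) (hx : x.length ≤ h) (hy : y.length ≤ h)
    (hd : wordDist x y = 6) (hc : c ≠ []) (hxc : wordDist x c = 3) (hcy : wordDist c y = 3) :
    TwoSteps h x y := by
  obtain ⟨z, hz, -, h1, h2⟩ := exists_branch (l := 1) hx hy hc (by omega) le_rfl (by omega)
    (by omega)
  exact ⟨by omega, by omega, z, hz, by omega, by omega⟩

theorem twoSteps_grandchild {w : List α} (a b : α) (hw : w.length + 4 ≤ h) :
    TwoSteps h w (w ++ [a, b]) := by
  obtain ⟨b', hb⟩ := exists_ne b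
  refine ⟨by simp, by simp, w ++ [a, b', b, b], by simpa using hw, by simp, ?_⟩
  simp [wordDist_cons_of_ne hb]

theorem twoSteps_siblings {w : List α} {a b : α} (hab : a ≠ b) (hw : w ≠ [])
    (hwh : w.length + 1 ≤ h) : TwoSteps h (w ++ [a]) (w ++ [b]) := by
  obtain hw' | ⟨w, t, rfl⟩ := List.eq_nil_or_concat w
  · exact absurd hw' hw
  rw [List.concat_eq_append] at *
  obtain ⟨t', ht⟩ := exists_ne t
  refine ⟨by simp [wordDist_cons_of_ne hab], by simp [wordDist_cons_of_ne hab], w ++ [t', t'],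
    by simp at hwh ⊢; omega, ?_, ?_⟩
  · simp [wordDist_cons_of_ne ht.symm]
  · simp [wordDist_cons_of_ne ht]

/-- If there are not four levels below `w`, then `h ≥ 5` gives `w` at least two ancestors, and the
detours run through other children of these. -/
theorem steps_grandchild (hh : 5 ≤ h) {w : List α} (a b : α) (hw : w.length + 2 ≤ h) :
    TwoSteps h w (w ++ [a, b]) ∨ ThreeSteps h w (w ++ [a, b]) ∧
      ∃ z : List α, z.length ≤ h ∧ TwoSteps h w z ∧ TwoSteps h z (w ++ [a, b]) := by
  by_cases hw4 : w.length + 4 ≤ h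
  · exact Or.inl (twoSteps_grandchild a b hw4)
  obtain ⟨w, s, t, rfl⟩ := exists_eq_append_pair (w := w) (by omega)
  obtain ⟨t', ht⟩ := exists_ne t
  obtain ⟨s', hs⟩ := exists_ne s
  simp only [List.length_append, List.length_cons, List.length_nil] at hw hw4
  refine Or.inr ⟨?_, w ++ [s', s', s', s'], by simp; omega, ?_, ?_⟩
  · refine TwoSteps.cons (z := w ++ [s, t', t', t']) (by simp; omega)
      (by simp [wordDist_cons_of_ne ht.symm])
      (twoSteps_of_six (w ++ [s]) (by simp; omega) (by simp; omega) ?_ (by simp) ?_ ?_)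
    all_goals simp [wordDist_cons_of_ne ht]
  · refine twoSteps_of_six (w ++ [s']) (by simp; omega) (by simp; omega) ?_ (by simp) ?_ ?_
    all_goals simp [wordDist_cons_of_ne hs.symm]
  · refine twoSteps_of_eight (by simp; omega) (by simp; omega) ?_
    simp [wordDist_cons_of_ne hs]

theorem steps_siblings (hh : 5 ≤ h) {w : List α} {a b : α} (hab : a ≠ b) (hw : w.length + 1 ≤ h) :
    TwoSteps h (w ++ [a]) (w ++ [b]) ∨ w = [] ∧ ThreeSteps h (w ++ [a]) (w ++ [b]) := by
  by_cases hw0 : w = []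
  · subst hw0
    -- The chain descends below `a` to depth 5, turns to depth 3, and crosses the root.
    refine Or.inr ⟨rfl, [a, a, a, a, a], [a, a, b], by simpa using hh, by simp; omega, ?_, ?_, ?_⟩
    all_goals simp [wordDist_cons_of_ne hab]
  · exact Or.inl (twoSteps_siblings hab hw0 hw)

/-- Only a midpoint at the root is a problem. Then both words have length 3, and a detour to depth 5
on the side of `x` lands at distance 8 from `y`. -/
theorem steps_six (hh : 5 ≤ h) {x y : List α} (hx : x.length ≤ h) (hy : y.length ≤ h)
    (hd : wordDist x y = 6) : TwoSteps h x y ∨ ThreeSteps h x y ∧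
      ∃ z : List α, z.length ≤ h ∧ TwoSteps h x z ∧ TwoSteps h z y := by
  obtain ⟨c, hc, hxc, hcy⟩ := exists_wordDist_split (i := 3) (j := 3) hx hy hd
  by_cases hc0 : c = []
  swap
  · exact Or.inl (twoSteps_of_six c hx hy hd hc0 hxc hcy)
  subst hc0
  rw [wordDist_nil_right] at hxc
  rw [wordDist_nil_left] at hcy
  match x, y, hxc, hcy with
  | [a, a1, a2], [b, b1, b2], _, _ =>
    have hab : a ≠ b := by
      rintro rfl
      have := wordDist_le [a1, a2] [b1, b2]
      simp at this hd
      omega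
    obtain ⟨a1', h1⟩ := exists_ne a1
    obtain ⟨a2', h2⟩ := exists_ne a2
    refine Or.inr ⟨?_, [a, a1', a, a, a], by simpa using hh, ?_, ?_⟩
    · refine TwoSteps.cons (z := [a, a1, a2', a, a]) (by simpa using hh) ?_
        (twoSteps_of_eight (by simpa using hh) hy ?_)
      · simp [wordDist_cons_of_ne h2.symm]
      · simp [wordDist_cons_of_ne hab]
    · refine twoSteps_of_six [a, a1'] hx (by simpa using hh) ?_ (by simp) ?_ ?_
      all_goals simp [wordDist_cons_of_ne h1.symm]
    · refine twoSteps_of_eight (by simpa using hh) hy ?_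
      simp [wordDist_cons_of_ne hab]

/-- Words at distance `2` or `6` are at most three steps apart. -/
theorem twoSteps_or_threeSteps (hh : 5 ≤ h) {x y : List α} (hx : x.length ≤ h)
    (hy : y.length ≤ h) (hd : wordDist x y = 2 ∨ wordDist x y = 6) :
    TwoSteps h x y ∨ ThreeSteps h x y := by
  rcases hd with hd | hd
  · obtain ⟨a, b, rfl⟩ | ⟨a, b, rfl⟩ | ⟨w, a, b, hab, rfl, rfl⟩ := wordDist_eq_two_cases hd
    · exact (steps_grandchild hh a b (by simpa using hy)).imp_right And.left
    · exact (steps_grandchild hh a b (by simpa using hx)).imp TwoSteps.symm fun h => h.1.symm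
    · exact (steps_siblings hh hab (by simpa using hx)).imp_right And.right
  · exact (steps_six hh hx hy hd).imp_right And.left

/-- Leaving the path by one edge at distance 3 from an end gives a step of length 4 to a vertex at
distance 8 from the other end. The two possible exits differ, so one of them is not the root. -/
theorem threeSteps_of_ten {x y : List α} (hx : x.length ≤ h) (hy : y.length ≤ h)
    (hd : wordDist x y = 10) : ThreeSteps h x y := by
  have aux : ∀ {x y c : List α}, x.length ≤ h → y.length ≤ h → wordDist x y = 10 → c ≠ [] →
      wordDist x c = 3 → wordDist c y = 7 → ThreeSteps h x y := by
    intro x y c hx hy hd hc h1 h2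
    obtain ⟨z, hz, -, h3, h4⟩ := exists_branch (l := 1) hx hy hc (by omega) le_rfl (by omega)
      (by omega)
    exact TwoSteps.cons hz (by omega) (twoSteps_of_eight hz hy (by omega))
  obtain ⟨c, -, h1, h2⟩ := exists_wordDist_split (i := 3) (j := 7) hx hy hd
  obtain ⟨c', -, h3, h4⟩ := exists_wordDist_split (i := 7) (j := 3) hx hy hd
  by_cases hc : c = []
  · refine (aux (c := c') hy hx (by rwa [wordDist_comm]) ?_ (by rwa [wordDist_comm])
      (by rwa [wordDist_comm])).symm
    rintro rfl
    subst hc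
    omega
  · exact aux hx hy hd hc h1 h2

/-- A vertex two steps away from both ends, found by leaving the path from `x` to `y` at `c`. -/
theorem exists_twoSteps_of_far {x y c c' : List α} {s : ℕ} (hx : x.length ≤ h) (hy : y.length ≤ h)
    (hs : s = 1 ∨ s = 2) (hd : wordDist x y = 8 + 2 * s) (hc : c ≠ []) (hc' : c' ≠ [])
    (hxc : wordDist x c = 5 + s) (hcc : wordDist c c' = s) (hcy : wordDist c' y = 3) :
    ∃ z : List α, z.length ≤ h ∧ TwoSteps h x z ∧ TwoSteps h z y := by
  have h1 := wordDist_triangle c c' y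
  have h2 := wordDist_triangle x c y
  -- The length `3 - s` makes `z` at distance 8 from `x` and at distance 3 from `c'`, so that `c'`
  -- is the midpoint of a path of length 6 from `z` to `y`.
  obtain ⟨z, hz, h3, h4, h5⟩ := exists_branch (l := 3 - s) hx hy hc (by omega) (by omega)
    (by omega) (by omega)
  have h6 := wordDist_triangle z c c'
  have h7 := wordDist_triangle z c' y
  rw [wordDist_comm z c] at h6
  exact ⟨z, hz, twoSteps_of_eight hx hz (by omega),
    twoSteps_of_six c' hz hy (by omega) hc' (by omega) hcy⟩

theorem exists_twoSteps_of_ten_or_twelve {x y : List α} {s : ℕ} (hx : x.length ≤ h)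
    (hy : y.length ≤ h) (hs : s = 1 ∨ s = 2) (hd : wordDist x y = 8 + 2 * s) :
    ∃ z : List α, z.length ≤ h ∧ TwoSteps h x z ∧ TwoSteps h z y := by
  obtain ⟨c, hc, h1, h2⟩ := exists_wordDist_split (i := 5 + s) (j := s + 3) hx hy (by omega)
  obtain ⟨c', hc', h3, h4⟩ := exists_wordDist_split hc hy h2
  by_cases h0 : c ≠ [] ∧ c' ≠ []
  · exact exists_twoSteps_of_far hx hy hs hd h0.1 h0.2 h1 h3 h4
  -- If the root is `c` or `c'`, the mirrored points `e`, `e'` are used. Their distances from `x`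
  -- are at most `s + 3`, those of `c`, `c'` at least `5 + s`, so neither is the root.
  obtain ⟨e, he, h5, h6⟩ := exists_wordDist_split (i := s + 3) (j := 5 + s) hx hy (by omega)
  obtain ⟨e', he', h7, h8⟩ := exists_wordDist_split (i := 3) (j := s) hx he (by omega)
  rw [wordDist_comm] at h5 h6 h7 h8 hd
  have h9 := wordDist_triangle x c c'
  have h10 := wordDist_triangle x c' y
  have h11 := wordDist_comm x y
  rw [wordDist_comm e' x] at h7
  have h12 := wordDist_comm e x
  obtain ⟨z, hz, h13, h14⟩ : ∃ z : List α, z.length ≤ h ∧ TwoSteps h y z ∧ TwoSteps h z x := by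
    refine exists_twoSteps_of_far (c := e) (c' := e') hy hx hs hd ?_ ?_ h6 h8
      (by rwa [wordDist_comm])
    · rintro rfl
      refine h0 ⟨?_, ?_⟩ <;> rintro rfl <;> omega
    · rintro rfl
      refine h0 ⟨?_, ?_⟩ <;> rintro rfl <;> omega
  exact ⟨z, hz, h14.symm, h13.symm⟩

theorem exists_twoSteps_of_four_zero {w : List α} (a b c d : α)
    (hw : w.length + 4 ≤ h) :
    ∃ z : List α, z.length ≤ h ∧ TwoSteps h w z ∧ TwoSteps h z (w ++ [a, b, c, d]) := by
  obtain ⟨a', ha⟩ := exists_ne a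
  refine ⟨w ++ [a', a'], by simp; omega, twoSteps_grandchild a' a' hw,
    twoSteps_of_six (w ++ [a]) (by simp; omega) (by simpa using hw) ?_ (by simp) ?_ ?_⟩
  all_goals simp [wordDist_cons_of_ne ha]

theorem exists_twoSteps_of_three_one (hh : 5 ≤ h) {w : List α} {a b : α} (c d : α) (hab : a ≠ b)
    (hw : w.length + 3 ≤ h) :
    ∃ z : List α, z.length ≤ h ∧ TwoSteps h (w ++ [a]) z ∧ TwoSteps h z (w ++ [b, c, d]) := by
  -- With five levels below `w`, a deep vertex below `b` is at distance 6 from both words. Otherwise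
  -- `w` has a parent, and a vertex below a sibling of `w` is at distances 6 and 8.
  by_cases hw5 : w.length + 5 ≤ h
  · obtain ⟨c', hc⟩ := exists_ne c
    refine ⟨w ++ [b, c', c', c', c'], by simpa using hw5,
      twoSteps_of_six (w ++ [b, c']) (by simp; omega) (by simpa using hw5) ?_ (by simp) ?_ ?_,
      twoSteps_of_six (w ++ [b, c']) (by simpa using hw5) (by simpa using hw) ?_ (by simp) ?_ ?_⟩
    all_goals simp [wordDist_cons_of_ne hab, wordDist_cons_of_ne hc]
  · obtain rfl | ⟨w, s, rfl⟩ := List.eq_nil_or_concat w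
    · simp at hw5; omega
    rw [List.concat_eq_append] at *
    obtain ⟨s', hs⟩ := exists_ne s
    simp only [List.length_append, List.length_cons, List.length_nil] at hw
    refine ⟨w ++ [s', s', s', s'], by simp; omega,
      twoSteps_of_six (w ++ [s']) (by simp; omega) (by simp; omega) ?_ (by simp) ?_ ?_,
      twoSteps_of_eight (by simp; omega) (by simp; omega) ?_⟩
    all_goals simp [wordDist_cons_of_ne hs, wordDist_cons_of_ne hs.symm]

theorem exists_twoSteps_of_two_two (hh : 5 ≤ h) {w : List α} (a b c d : α)
    (hw : w.length + 2 ≤ h) :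
    ∃ z : List α, z.length ≤ h ∧ TwoSteps h (w ++ [a, c]) z ∧ TwoSteps h z (w ++ [b, d]) := by
  by_cases hw4 : w.length + 4 ≤ h
  · exact ⟨w, by omega, (twoSteps_grandchild a c hw4).symm, twoSteps_grandchild b d hw4⟩
  obtain ⟨w, s, t, rfl⟩ := exists_eq_append_pair (w := w) (by omega)
  obtain ⟨t', ht⟩ := exists_ne t
  simp only [List.length_append, List.length_cons, List.length_nil] at hw
  refine ⟨w ++ [s, t', t', t'], by simp; omega,
    twoSteps_of_six (w ++ [s]) (by simp; omega) (by simp; omega) ?_ (by simp) ?_ ?_,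
    twoSteps_of_six (w ++ [s]) (by simp; omega) (by simp; omega) ?_ (by simp) ?_ ?_⟩
  all_goals simp [wordDist_cons_of_ne ht, wordDist_cons_of_ne ht.symm]

/-- Words at distance `4` have a common vertex at two steps. -/
theorem exists_twoSteps_of_four (hh : 5 ≤ h) {x y : List α} (hx : x.length ≤ h)
    (hy : y.length ≤ h) (hd : wordDist x y = 4) :
    ∃ z : List α, z.length ≤ h ∧ TwoSteps h x z ∧ TwoSteps h z y := by
  have swap : ∀ {x y : List α}, (∃ z : List α, z.length ≤ h ∧ TwoSteps h x z ∧ TwoSteps h z y) →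
      ∃ z : List α, z.length ≤ h ∧ TwoSteps h y z ∧ TwoSteps h z x :=
    fun ⟨z, h1, h2, h3⟩ => ⟨z, h1, h3.symm, h2.symm⟩
  obtain ⟨w, p, q, rfl, rfl, h1, rfl | rfl | ⟨a, b, p, q, hab, rfl, rfl⟩⟩ :=
    exists_append_of_wordDist x y
  · match q, h1.symm.trans hd with
    | [a, b, c, d], _ =>
      simpa using exists_twoSteps_of_four_zero a b c d (by simpa using hy)
  · match p, h1.symm.trans hd with
    | [a, b, c, d], _ =>
      simpa using swap (exists_twoSteps_of_four_zero a b c d (by simpa using hx))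
  · have hl : p.length + q.length = 2 := by
      have := h1.symm.trans hd
      simp only [List.length_cons] at this
      omega
    match p, q, hl with
    | [], [c, d], _ => exact exists_twoSteps_of_three_one hh c d hab (by simpa using hy)
    | [c], [d], _ => exact exists_twoSteps_of_two_two hh a b c d (by simpa using hx)
    | [c, d], [], _ =>
      exact swap (exists_twoSteps_of_three_one hh c d hab.symm (by simpa using hx))
    | [], [], hl => simp at hl
    | [], [_], hl => simp at hl
    | [], _ :: _ :: _ :: _, hl => simp at hl
    | [_], [], hl => simp at hl
    | [_], _ :: _ :: _, hl => simp at hl; omega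
    | [_, _], _ :: _, hl => simp at hl
    | _ :: _ :: _ :: _, _, hl => simp at hl; omega

/-- A vertex at depth 7 below `a` is at distances 6 and 8 from the two words; this is why the
exception ends at `h = 7`. -/
theorem exists_twoSteps_top (hh : 7 ≤ h) {a b : α} (hab : a ≠ b) :
    ∃ z : List α, z.length ≤ h ∧ TwoSteps h [a] z ∧ TwoSteps h z [b] := by
  refine ⟨[a, a, a, a, a, a, a], by simpa using hh, ?_, ?_⟩
  · exact twoSteps_of_six [a, a, a, a] (by simp; omega) (by simpa using hh) (by simp) (by simp)
      (by simp) (by simp)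
  · exact twoSteps_of_eight (by simpa using hh) (by simp; omega)
      (by simp [wordDist_cons_of_ne hab])

end TwoSteps

/-! ### From words to the tree and its second metamour graph -/

section Tree

variable {h m : ℕ}

/-- The distance in the complete tree, computed from the words. -/
def treeDist (x y : TreeVertex h m) : ℕ :=
  wordDist x.1.reverse y.1.reverse

/-- The vertex reached from the root along the letters of a word. -/
def ofWord (w : List (Fin m)) (hw : w.length ≤ h) : TreeVertex h m :=
  ⟨w.reverse, by simpa using hw⟩

@[simp] theorem ofWord_reverse (w : List (Fin m)) (hw : w.length ≤ h) :
    (ofWord w hw).1.reverse = w := by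
  simp [ofWord]

theorem length_reverse_le (x : TreeVertex h m) : x.1.reverse.length ≤ h := by
  simpa using x.2

theorem eq_of_reverse_eq {x y : TreeVertex h m} (hxy : x.1.reverse = y.1.reverse) : x = y :=
  Subtype.ext (List.reverse_injective hxy)

theorem treeDist_eq_zero_iff {x y : TreeVertex h m} : treeDist x y = 0 ↔ x = y := by
  unfold treeDist
  rw [wordDist_eq_zero_iff]
  exact ⟨eq_of_reverse_eq, fun hxy => by rw [hxy]⟩

theorem treeDist_parity (x y : TreeVertex h m) :
    treeDist x y % 2 = (x.1.length + y.1.length) % 2 := by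
  simpa [treeDist] using wordDist_parity x.1.reverse y.1.reverse

theorem treeDist_triangle (x y z : TreeVertex h m) :
    treeDist x z ≤ treeDist x y + treeDist y z :=
  wordDist_triangle _ _ _

theorem exists_treeDist_split {x y : TreeVertex h m} {i j : ℕ} (hd : treeDist x y = i + j) :
    ∃ z : TreeVertex h m, treeDist x z = i ∧ treeDist z y = j := by
  obtain ⟨z, hz, h1, h2⟩ := exists_wordDist_split (length_reverse_le x) (length_reverse_le y) hd
  exact ⟨ofWord z hz, by simpa [treeDist] using h1, by simpa [treeDist] using h2⟩

theorem completeTree_adj_iff {x y : TreeVertex h m} :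
    (completeTree h m).Adj x y ↔ treeDist x y = 1 := by
  constructor
  · rintro (⟨a, ha⟩ | ⟨a, ha⟩) <;> simp [treeDist, ha]
  · intro hd
    obtain ⟨w, p, q, hx, hy, h1, hpq⟩ := exists_append_of_wordDist x.1.reverse y.1.reverse
    have hl := h1.symm.trans hd
    rw [List.reverse_eq_iff] at hx hy
    rcases hpq with rfl | rfl | ⟨a, b, p, q, hab, rfl, rfl⟩
    · match q, hl with
      | [a], _ => exact Or.inl ⟨a, by rw [hx, hy]; simp⟩
    · match p, hl with
      | [a], _ => exact Or.inr ⟨a, by rw [hx, hy]; simp⟩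
    · simp only [List.length_cons] at hl
      omega

/-- Passing from tree distance `n` to tree distance `2 * n` in the metamour graph. -/
theorem metamour_adj_iff_treeDist {G : SimpleGraph (TreeVertex h m)} {n : ℕ} (hn : n = 1 ∨ n = 2)
    (hG : ∀ x y, G.Adj x y ↔ treeDist x y = n) (x y : TreeVertex h m) :
    (metamour G).Adj x y ↔ treeDist x y = 2 * n := by
  rw [metamour_adj_iff]
  simp only [hG, ne_eq, ← treeDist_eq_zero_iff]
  constructor
  · rintro ⟨h0, h1, z, h2, h3⟩
    have h4 := treeDist_triangle x z y
    have h5 := treeDist_parity x y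
    have h6 := treeDist_parity x z
    have h7 := treeDist_parity z y
    -- The distance is even and at most `2 * n`; for `n = 2` the value 2 is excluded because both
    -- steps are even and 4 is the only even nonzero candidate besides 2, which is an edge already.
    rcases hn with rfl | rfl <;> omega
  · intro hd
    exact ⟨by omega, by omega, exists_treeDist_split (by omega)⟩

theorem metamourIter_two_adj_iff {x y : TreeVertex h m} :
    (metamourIter (completeTree h m) 2).Adj x y ↔ treeDist x y = 4 :=
  metamour_adj_iff_treeDist (n := 2) (Or.inr rfl)
    (metamour_adj_iff_treeDist (n := 1) (Or.inl rfl) fun _ _ => completeTree_adj_iff) x y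

theorem edist_eq_one_iff {x y : TreeVertex h m} :
    (metamourIter (completeTree h m) 2).edist x y = 1 ↔ treeDist x y = 4 :=
  SimpleGraph.edist_eq_one_iff_adj.trans metamourIter_two_adj_iff

theorem edist_eq_two_iff {x y : TreeVertex h m} :
    (metamourIter (completeTree h m) 2).edist x y = 2 ↔
      TwoSteps h x.1.reverse y.1.reverse := by
  change (metamour (metamourIter (completeTree h m) 2)).Adj x y ↔ _
  rw [metamour_adj_iff]
  simp only [metamourIter_two_adj_iff, ne_eq, ← treeDist_eq_zero_iff]
  refine and_congr_right fun _ => and_congr_right fun _ => ⟨?_, ?_⟩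
  · rintro ⟨z, h1, h2⟩
    exact ⟨z.1.reverse, length_reverse_le z, h1, h2⟩
  · rintro ⟨z, hz, h1, h2⟩
    exact ⟨ofWord z hz, by simpa [treeDist] using h1, by simpa [treeDist] using h2⟩

/-- Every edge of $M^2(T)$ spans tree distance 4. This bounds its distances from below and keeps its
components within one parity of depth. -/
theorem treeDist_of_edist_eq {x y : TreeVertex h m} {n : ℕ}
    (hn : (metamourIter (completeTree h m) 2).edist x y = n) :
    treeDist x y ≤ 4 * n ∧ treeDist x y % 2 = 0 := by
  induction n generalizing x with
  | zero => simp [treeDist_eq_zero_iff.2 (eq_of_edist_eq_natCast_zero hn)]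
  | succ n ih =>
    rw [add_comm] at hn
    obtain ⟨z, h1, h2⟩ := exists_edist_split hn
    have h3 := edist_eq_one_iff.1 (by simpa using h1)
    have h4 := ih h2
    have h5 := treeDist_triangle x z y
    have h6 := treeDist_parity x y
    have h7 := treeDist_parity x z
    have h8 := treeDist_parity z y
    omega

theorem edist_le_add_one {x y z : TreeVertex h m} {n : ℕ} (hxz : treeDist x z = 4)
    (hzy : (metamourIter (completeTree h m) 2).edist z y ≤ n) :
    (metamourIter (completeTree h m) 2).edist x y ≤ (n + 1 : ℕ) := by
  refine SimpleGraph.edist_triangle.trans ((add_le_add (edist_eq_one_iff.2 hxz).le hzy).trans ?_)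
  rw [add_comm]
  exact le_rfl

theorem ThreeSteps.edist_le {x y : TreeVertex h m}
    (hxy : ThreeSteps h x.1.reverse y.1.reverse) :
    (metamourIter (completeTree h m) 2).edist x y ≤ (3 : ℕ) := by
  obtain ⟨z, z', hz, hz', h1, h2, h3⟩ := hxy
  refine edist_le_add_one (z := ofWord z hz) (by simpa [treeDist] using h1)
    (edist_le_add_one (z := ofWord z' hz') (by simpa [treeDist] using h2) ?_)
  rw [edist_eq_one_iff.2 (by simpa [treeDist] using h3)]
  rfl

theorem edist_le_of_treeDist_eq_four_mul (q : ℕ) {x y : TreeVertex h m}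
    (hd : treeDist x y = 4 * q) :
    (metamourIter (completeTree h m) 2).edist x y ≤ (q : ℕ) := by
  induction q generalizing x with
  | zero => simp [treeDist_eq_zero_iff.1 hd]
  | succ q ih =>
    obtain ⟨z, h1, h2⟩ := exists_treeDist_split (i := 4) (j := 4 * q)
      (x := x) (y := y) (by omega)
    exact edist_le_add_one h1 (ih h2)

theorem exists_edist_eq_two_of_twoSteps {x y : TreeVertex h m} (hz : ∃ z : List (Fin m),
    z.length ≤ h ∧ TwoSteps h x.1.reverse z ∧ TwoSteps h z y.1.reverse) :
    ∃ z, (metamourIter (completeTree h m) 2).edist x z = 2 ∧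
      (metamourIter (completeTree h m) 2).edist z y = 2 := by
  obtain ⟨z, hz, h1, h2⟩ := hz
  exact ⟨ofWord z hz, edist_eq_two_iff.2 (by simpa using h1), edist_eq_two_iff.2 (by simpa using h2)⟩

/-! ### Upper bounds for the distances in the second metamour graph -/

section Distances

variable [Nontrivial (Fin m)]

/-- Steps along the path reduce to tree distance 10, where three steps suffice. The bound matches
the lower bound of a quarter of the tree distance, rounded up. -/
theorem edist_le_of_treeDist_eq_ten_add (q : ℕ) {x y : TreeVertex h m}
    (hd : treeDist x y = 10 + 4 * q) :
    (metamourIter (completeTree h m) 2).edist x y ≤ (q + 3 : ℕ) := by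
  induction q generalizing x with
  | zero =>
    simpa using (threeSteps_of_ten (length_reverse_le x) (length_reverse_le y) hd).edist_le
  | succ q ih =>
    obtain ⟨z, h1, h2⟩ := exists_treeDist_split (i := 4) (j := 10 + 4 * q)
      (x := x) (y := y) (by omega)
    have := edist_le_add_one h1 (ih h2)
    rwa [show q + 1 + 3 = q + 3 + 1 by ring]

/-- Vertices at even tree distance have a distance of at most `⌈h / 2⌉` in the second metamour
graph. -/
theorem edist_le_of_even (hh : 5 ≤ h) {x y : TreeVertex h m} (hd : treeDist x y % 2 = 0) :
    (metamourIter (completeTree h m) 2).edist x y ≤ ((h + 1) / 2 : ℕ) := by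
  have hle := wordDist_le x.1.reverse y.1.reverse
  change treeDist x y ≤ _ at hle
  have hx := length_reverse_le x
  have hy := length_reverse_le y
  by_cases h4 : treeDist x y % 4 = 0
  · refine (edist_le_of_treeDist_eq_four_mul (treeDist x y / 4) (by omega)).trans ?_
    exact_mod_cast (by omega)
  by_cases h26 : treeDist x y = 2 ∨ treeDist x y = 6
  · have h3 : (metamourIter (completeTree h m) 2).edist x y ≤ (3 : ℕ) := by
      rcases twoSteps_or_threeSteps hh hx hy h26 with h2 | h3
      · rw [edist_eq_two_iff.2 h2]
        decide
      · exact h3.edist_le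
    refine h3.trans ?_
    exact_mod_cast (by omega)
  · refine (edist_le_of_treeDist_eq_ten_add ((treeDist x y - 10) / 4) (by omega)).trans ?_
    exact_mod_cast (by omega)

theorem edist_le_of_edist_eq (hh : 5 ≤ h) {x y : TreeVertex h m} {n : ℕ}
    (hn : (metamourIter (completeTree h m) 2).edist x y = n) : n ≤ (h + 1) / 2 := by
  have := edist_le_of_even hh (treeDist_of_edist_eq hn).2
  rw [hn] at this
  exact_mod_cast this

end Distances

theorem treeDepth_eq_one_iff {x : TreeVertex h m} : treeDepth x = 1 ↔ x.1.length = 1 := by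
  unfold treeDepth
  rw [SimpleGraph.edist_eq_one_iff_adj, completeTree_adj_iff]
  simp [treeDist, treeRoot]

theorem exists_third {a b : Fin m} (hm : 3 ≤ m) : ∃ c, a ≠ c ∧ b ≠ c := by
  by_contra! hc
  have : (Finset.univ : Finset (Fin m)) ⊆ {a, b} := by
    intro c _
    by_cases hac : a = c
    · simp [hac]
    · simp [hc c hac]
  have h1 := Finset.card_le_card this
  have h2 := Finset.card_le_two (a := a) (b := b)
  simp at h1
  omega

/-! ### Pairs at distance three and the exceptional pairs -/

section Exceptional

variable [Nontrivial (Fin m)]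

/-- The tree distance is even and at most 12, and the values 0, 4 and 8 correspond to distances 0, 1
and 2. This leaves 2, 6, 10 and 12. -/
theorem exists_edist_eq_two_of_edist_eq_three (hh : 5 ≤ h) (hm : 2 ≤ m) {x y : TreeVertex h m}
    (hd : (metamourIter (completeTree h m) 2).edist x y = 3) (hxy : ¬ IsExceptionalPair x y) :
    ∃ z, (metamourIter (completeTree h m) 2).edist x z = 2 ∧
      (metamourIter (completeTree h m) 2).edist z y = 2 := by
  have hle := treeDist_of_edist_eq (n := 3) hd
  have hx := length_reverse_le x
  have hy := length_reverse_le y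
  have h2 : ¬ TwoSteps h x.1.reverse y.1.reverse := by
    rw [← edist_eq_two_iff, hd]
    decide
  have h0 : treeDist x y ≠ 0 := by
    rw [ne_eq, treeDist_eq_zero_iff]
    rintro rfl
    simp at hd
  have h4 : treeDist x y ≠ 4 := by
    rw [ne_eq, ← edist_eq_one_iff, hd]
    decide
  have h8 : treeDist x y ≠ 8 := fun h8 => h2 (twoSteps_of_eight hx hy h8)
  apply exists_edist_eq_two_of_twoSteps
  have hcases : treeDist x y = 2 ∨ treeDist x y = 6 ∨ treeDist x y = 8 + 2 * 1 ∨
      treeDist x y = 8 + 2 * 2 := by omega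
  rcases hcases with hd | hd | hd | hd
  · obtain ⟨a, b, hw⟩ | ⟨a, b, hw⟩ | ⟨w, a, b, hab, hxw, hyw⟩ := wordDist_eq_two_cases hd
    · rw [hw] at h2 hy ⊢
      exact ((steps_grandchild hh a b (by simpa using hy)).resolve_left h2).2
    · rw [hw] at h2 hx ⊢
      obtain ⟨z, hz, h5, h6⟩ := ((steps_grandchild hh a b (by simpa using hx)).resolve_left
        fun h => h2 h.symm).2
      exact ⟨z, hz, h6.symm, h5.symm⟩
    · have hxy' := hxy
      unfold IsExceptionalPair at hxy'
      rw [treeDepth_eq_one_iff, treeDepth_eq_one_iff, ← List.length_reverse (as := x.1),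
        ← List.length_reverse (as := y.1), hxw, hyw] at hxy'
      rw [hxw, hyw] at h2 ⊢
      rw [hxw] at hx
      obtain ⟨rfl, -⟩ := (steps_siblings hh hab (by simpa using hx)).resolve_left h2
      have hm3 : ¬ 3 ≤ m := fun hm3 => by
        obtain ⟨c, hac, hbc⟩ := exists_third (a := a) (b := b) hm3
        exact h2 (twoSteps_top hab hac hbc (by omega))
      have hh7 : 7 ≤ h := by
        by_contra hh7
        exact hxy' ⟨rfl, rfl, by omega, by omega⟩
      exact exists_twoSteps_top hh7 hab
  · exact ((steps_six hh hx hy hd).resolve_left h2).2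
  · exact exists_twoSteps_of_ten_or_twelve hx hy (Or.inl rfl) hd
  · exact exists_twoSteps_of_ten_or_twelve hx hy (Or.inr rfl) hd

/-- Parity and `h ≤ 6` put `z` two or four levels below `x`. Its tree distances from `x` and `y` are
then 2 and 4, or 4 and 6. -/
theorem edist_of_below_child (hh : 5 ≤ h) (hh6 : h ≤ 6) {a b : Fin m} (hab : a ≠ b)
    {x y z : TreeVertex h m} {w : List (Fin m)} (hx : x.1.reverse = [a]) (hy : y.1.reverse = [b])
    (hz : z.1.reverse = a :: w) {p : ℕ} (hp0 : p ≠ 0)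
    (hp : (metamourIter (completeTree h m) 2).edist x z = p) :
    (metamourIter (completeTree h m) 2).edist x z = 2 ∧
        (metamourIter (completeTree h m) 2).edist z y = 1 ∨
      (metamourIter (completeTree h m) 2).edist x z = 1 ∧
        (metamourIter (completeTree h m) 2).edist z y = 2 := by
  have hpar := (treeDist_of_edist_eq hp).2
  have hlen := length_reverse_le z
  simp only [treeDist, hx, hz, wordDist_cons_self, wordDist_nil_left] at hpar
  rw [hz, List.length_cons] at hlen
  rw [edist_eq_two_iff, edist_eq_one_iff, edist_eq_one_iff, edist_eq_two_iff, treeDist, treeDist,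
    hx, hy, hz]
  match w, hpar, hlen with
  | [], _, _ =>
    have : x = z := eq_of_reverse_eq (by rw [hx, hz])
    subst this
    rw [SimpleGraph.edist_self] at hp
    exact absurd (by exact_mod_cast hp.symm) hp0
  | [s, t], _, _ =>
    exact Or.inl ⟨twoSteps_grandchild (w := [a]) s t (by simpa using hh),
      by simp [wordDist_cons_of_ne hab]⟩
  | [s, t, u, v], _, hl =>
    refine Or.inr ⟨by simp, twoSteps_of_six [a, s] (by simpa using hl) (by simp; omega) ?_
      (by simp) ?_ ?_⟩
    all_goals simp [wordDist_cons_of_ne hab]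
  | [_], hl, _ => simp at hl
  | [_, _, _], hl, _ => simp at hl
  | _ :: _ :: _ :: _ :: _ :: w, hl, hl' =>
    simp only [List.length_cons] at hl hl'
    omega

/-- The root is at odd distance from `x`, so `z` lies below one of the two children. Its distances
are then 1 and 2, of different parity classes. -/
theorem not_clog_modEq_of_exceptional {x y : TreeVertex h m} (hxy : IsExceptionalPair x y)
    (hne : x ≠ y) (z : TreeVertex h m) (p q : ℕ)
    (hp : (metamourIter (completeTree h m) 2).edist x z = p)
    (hq : (metamourIter (completeTree h m) 2).edist z y = q) (hp0 : p ≠ 0) (hq0 : q ≠ 0) :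
    ¬ Nat.clog 2 p ≡ Nat.clog 2 q [MOD 2] := by
  obtain ⟨hx, hy, rfl, hh⟩ := hxy
  rw [treeDepth_eq_one_iff, ← List.length_reverse, List.length_eq_one_iff] at hx hy
  obtain ⟨a, hx⟩ := hx
  obtain ⟨b, hy⟩ := hy
  have hab : a ≠ b := by
    rintro rfl
    exact hne (eq_of_reverse_eq (hx.trans hy.symm))
  have key : (p = 2 ∧ q = 1) ∨ (p = 1 ∧ q = 2) := by
    rcases hz : z.1.reverse with _ | ⟨c, w⟩
    · have := (treeDist_of_edist_eq hp).2
      simp [treeDist, hx, hz] at this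
    have hc : c = a ∨ c = b := by omega
    rcases hc with rfl | rfl
    · have := edist_of_below_child (by omega) (by omega) hab hx hy hz hp0 hp
      rw [hp, hq] at this
      exact_mod_cast this
    · rw [SimpleGraph.edist_comm] at hp hq
      have := edist_of_below_child (by omega) (by omega) hab.symm hy hx hz hq0 hq
      rw [hp, hq] at this
      have h' : (q = 2 ∧ p = 1) ∨ (q = 1 ∧ p = 2) := by exact_mod_cast this
      omega
  have c2 : Nat.clog 2 2 = 0 + 1 := clog_two_eq_succ 0 (by norm_num) (by norm_num)
  rcases key with ⟨rfl, rfl⟩ | ⟨rfl, rfl⟩ <;> rw [c2] <;> simp [Nat.ModEq]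

end Exceptional

/-- The iterated metamour graphs of the complete tree from the second one on. -/
theorem metamourIter_add_two_adj_iff (hh : 5 ≤ h) (hm : 2 ≤ m) (j : ℕ) (x y : TreeVertex h m) :
    (metamourIter (completeTree h m) (j + 2)).Adj x y ↔ ¬ (IsExceptionalPair x y ∧ x ≠ y) ∧
      ∃ n : ℕ, (metamourIter (completeTree h m) 2).edist x y = n ∧ n ≠ 0 ∧ n ≤ 2 ^ j ∧
        Nat.clog 2 n ≡ j [MOD 2] := by
  have : Nontrivial (Fin m) := Fin.nontrivial_iff_two_le.2 hm
  have hadd : ∀ j, metamourIter (completeTree h m) (j + 2) =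
      metamourIter (metamourIter (completeTree h m) 2) j := by
    intro j
    induction j with
    | zero => rfl
    | succ j ih => exact congrArg metamour ih
  have hexc : ∀ x y : TreeVertex h m, IsExceptionalPair x y ∧ x ≠ y →
      (metamourIter (completeTree h m) 2).edist x y ≠ 1 := by
    rintro x y ⟨⟨hx, hy, -, -⟩, -⟩ h1
    rw [treeDepth_eq_one_iff] at hx hy
    rw [edist_eq_one_iff] at h1
    have := wordDist_le x.1.reverse y.1.reverse
    simp only [treeDist, List.length_reverse] at this h1
    omega
  rw [hadd]
  refine metamourIter_adj_iff (fun x y => IsExceptionalPair x y ∧ x ≠ y) ?_ ?_ hexc ?_ ?_ ?_ j x y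
  · intro x y h1
    exact exists_edist_eq_two_of_twoSteps (exists_twoSteps_of_four hh (length_reverse_le x)
      (length_reverse_le y) (edist_eq_one_iff.1 h1))
  · intro x y h3 hxy
    have hne : x ≠ y := by
      rintro rfl
      simp at h3
    exact exists_edist_eq_two_of_edist_eq_three hh hm h3 fun he => hxy ⟨he, hne⟩
  · rintro x y ⟨hxy, hne⟩ h2
    obtain ⟨z, h1, h3⟩ := exists_edist_split (i := 1) (j := 1) h2
    exact not_clog_modEq_of_exceptional hxy hne z 1 1 h1 h3 one_ne_zero one_ne_zero rfl
  · rintro x y ⟨⟨-, -, -, h56⟩, -⟩ u v n hn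
    have := edist_le_of_edist_eq hh hn
    omega
  · rintro x y ⟨hxy, hne⟩ z a b ha hb ha0 hb0
    exact not_clog_modEq_of_exceptional hxy hne z a b ha hb ha0 hb0

end Tree

/-! ### Preperiod, period and limit set -/

theorem ceil_logb_two_natCast (n : ℕ) : ⌈Real.logb 2 (n : ℝ)⌉ = (Nat.clog 2 n : ℤ) := by
  have := Real.ceil_logb_natCast (b := 2) (r := (n : ℝ)) (Nat.cast_nonneg n)
  rwa [Int.clog_natCast] at this

theorem metamourIter_add_two_eq {V : Type*} {G : SimpleGraph V} {k : ℕ}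
    (hk : metamourIter G k = metamourIter G (k + 2)) (i : ℕ) :
    metamourIter G (k + i) = metamourIter G (k + i + 2) := by
  induction i with
  | zero => exact hk
  | succ i ih => exact congrArg metamour ih

section Limit

variable {h m : ℕ}

theorem half_le_of_clog_le {j : ℕ} (hj : Nat.clog 2 h ≤ j + 2) :
    (h + 1) / 2 ≤ 2 ^ (j + 1) := by
  have := (Nat.clog_le_iff_le_pow one_lt_two).1 hj
  rw [pow_succ] at this
  omega

theorem three_le_clog (hh : 5 ≤ h) : 3 ≤ Nat.clog 2 h :=
  (Nat.lt_clog_iff_pow_lt one_lt_two).2 (by omega)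

/-- The iterated metamour graphs of the complete tree beyond the preperiod. -/
theorem metamourIter_adj_iff_of_clog_le (hh : 5 ≤ h) (hm : 2 ≤ m) {k : ℕ}
    (hk : Nat.clog 2 h ≤ k) (x y : TreeVertex h m) :
    (metamourIter (completeTree h m) k).Adj x y ↔ ¬ (IsExceptionalPair x y ∧ x ≠ y) ∧
      ∃ n : ℕ, (metamourIter (completeTree h m) 2).edist x y = n ∧ n ≠ 0 ∧
        Nat.clog 2 n ≡ k [MOD 2] := by
  have : Nontrivial (Fin m) := Fin.nontrivial_iff_two_le.2 hm
  have h3 := three_le_clog hh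
  obtain ⟨j, rfl⟩ : ∃ j, k = j + 2 := ⟨k - 2, by omega⟩
  rw [metamourIter_add_two_adj_iff hh hm]
  refine and_congr_right fun _ => exists_congr fun n => and_congr_right fun hn =>
    and_congr_right fun _ => ?_
  have hle := (edist_le_of_edist_eq hh hn).trans (half_le_of_clog_le hk)
  constructor
  · rintro ⟨-, hc⟩
    unfold Nat.ModEq at *
    omega
  · intro hc
    refine ⟨?_, by unfold Nat.ModEq at *; omega⟩
    -- A distance above $2^j$ would lie in $(2^j, 2^{j+1}]$, where the parity is wrong.
    by_contra hj
    rw [clog_two_eq_succ j (by omega) hle] at hc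
    unfold Nat.ModEq at hc
    omega

theorem metamourIter_eq_add_two (hh : 5 ≤ h) (hm : 2 ≤ m) {k : ℕ} (hk : Nat.clog 2 h ≤ k) :
    metamourIter (completeTree h m) k = metamourIter (completeTree h m) (k + 2) := by
  ext x y
  rw [metamourIter_adj_iff_of_clog_le hh hm hk,
    metamourIter_adj_iff_of_clog_le hh hm (hk.trans (Nat.le_add_right k 2))]
  simp [Nat.ModEq]

theorem metamourIter_ne_add_two (hh : 5 ≤ h) (hm : 2 ≤ m) {k : ℕ} (hk : k < Nat.clog 2 h) :
    metamourIter (completeTree h m) k ≠ metamourIter (completeTree h m) (k + 2) := by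
  have : Nontrivial (Fin m) := Fin.nontrivial_iff_two_le.2 hm
  intro heq
  have h3 := three_le_clog hh
  obtain ⟨j, hj⟩ : ∃ j, Nat.clog 2 h = j + 2 + 1 := ⟨Nat.clog 2 h - 3, by omega⟩
  -- Equality persists under $M$, so it would hold at `j + 2`, the last index before the claimed
  -- preperiod.
  have heq' := metamourIter_add_two_eq heq (j + 2 - k)
  rw [show k + (j + 2 - k) = j + 2 by omega] at heq'
  obtain ⟨hlt, hle⟩ := clog_two_eq_succ_iff.1 hj
  obtain ⟨a, b, hab⟩ := exists_pair_ne (Fin m)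
  -- Two leaves on opposite sides of the root have distance $\lceil h/2\rceil$, which lies in
  -- $(2^{j+1}, 2^{j+2}]$. They are adjacent at index `j + 4` but too far apart at `j + 2`.
  let x : TreeVertex h m := ofWord (List.replicate h a) (by simp)
  let y : TreeVertex h m := ofWord (List.replicate h b) (by simp)
  have hd : treeDist x y = 2 * h := by
    obtain ⟨h, rfl⟩ : ∃ h', h = h' + 1 := ⟨h - 1, by omega⟩
    simp only [treeDist, x, y, ofWord_reverse, List.replicate_succ, wordDist_cons_of_ne hab,
      List.length_replicate]
    ring
  have hedist := edist_le_of_even hh (x := x) (y := y) (by omega)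
  obtain ⟨n, hn⟩ := ENat.ne_top_iff_exists.1
    (ne_top_of_le_ne_top (ENat.natCast_ne_top _) hedist)
  have h1 := treeDist_of_edist_eq hn.symm
  have h2 := edist_le_of_edist_eq hh hn.symm
  have p1 : 2 ^ (j + 2) = 4 * 2 ^ j := by ring
  have p2 : 2 ^ (j + 1) = 2 * 2 ^ j := by ring
  have p3 : 2 ^ (j + 2 + 1) = 8 * 2 ^ j := by ring
  have hexc : ¬ (IsExceptionalPair x y ∧ x ≠ y) := by
    rintro ⟨⟨hx, -⟩, -⟩
    rw [treeDepth_eq_one_iff] at hx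
    simp [x, ofWord] at hx
    omega
  have hadj : (metamourIter (completeTree h m) (j + 2 + 2)).Adj x y :=
    (metamourIter_add_two_adj_iff hh hm (j + 2) x y).2 ⟨hexc, n, hn.symm, by omega, by omega, by
      rw [clog_two_eq_succ (j + 1) (by omega) (by omega)]⟩
  rw [← heq', metamourIter_add_two_adj_iff hh hm] at hadj
  obtain ⟨-, n', hn', -, hle', -⟩ := hadj
  have : n = n' := by exact_mod_cast hn.trans hn'
  omega

/-- The root and a vertex of depth 4 are at distance 1 in $M^2(T)$, so late in the sequence they are
adjacent exactly at even indices. -/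
theorem metamourIter_ne_succ (hh : 5 ≤ h) (hm : 2 ≤ m) {k : ℕ} (hk : Nat.clog 2 h ≤ k) :
    metamourIter (completeTree h m) k ≠ metamourIter (completeTree h m) (k + 1) := by
  intro heq
  let a : Fin m := ⟨0, by omega⟩
  let x : TreeVertex h m := treeRoot h m
  let y : TreeVertex h m := ofWord [a, a, a, a] (by simp; omega)
  have hn : (metamourIter (completeTree h m) 2).edist x y = (1 : ℕ) := by
    have : treeDist x y = 4 := by simp [treeDist, x, y, treeRoot]
    exact_mod_cast edist_eq_one_iff.2 this
  have hexc : ¬ (IsExceptionalPair x y ∧ x ≠ y) := by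
    rintro ⟨⟨hx, -⟩, -⟩
    rw [treeDepth_eq_one_iff] at hx
    simp [x, treeRoot] at hx
  have key : ∀ i, Nat.clog 2 h ≤ i → ((metamourIter (completeTree h m) i).Adj x y ↔ i % 2 = 0) := by
    intro i hi
    rw [metamourIter_adj_iff_of_clog_le hh hm hi]
    constructor
    · rintro ⟨-, n, hn', -, hc⟩
      have : 1 = n := by exact_mod_cast hn.symm.trans hn'
      subst this
      simp [Nat.ModEq] at hc
      omega
    · intro hi
      exact ⟨hexc, 1, hn, one_ne_zero, by simp [Nat.ModEq]; omega⟩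
  have h1 := key k hk
  have h2 := key (k + 1) (by omega)
  rw [← heq, h1] at h2
  omega

theorem metamourLimitSet_completeTree (hh : 5 ≤ h) (hm : 2 ≤ m) {k : ℕ} (hk : Nat.clog 2 h ≤ k) :
    metamourLimitSet (completeTree h m) =
      {metamourIter (completeTree h m) k, metamourIter (completeTree h m) (k + 1)} := by
  have key : ∀ t l, Nat.clog 2 h ≤ l →
      metamourIter (completeTree h m) (l + 2 * t) = metamourIter (completeTree h m) l := by
    intro t l hl
    induction t with
    | zero => rfl
    | succ t ih => exact (metamourIter_eq_add_two hh hm (hl.trans (Nat.le_add_right l _))).symm.trans ih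
  ext H
  simp only [metamourLimitSet, Set.mem_ofPred_eq, Set.mem_insert_iff, Set.mem_singleton_iff]
  constructor
  · intro hH
    obtain ⟨i, hi, rfl⟩ := hH k
    rcases Nat.mod_two_eq_zero_or_one (i - k) with hp | hp
    · left
      rw [← key ((i - k) / 2) k hk]
      congr 1
      omega
    · right
      rw [← key ((i - k) / 2) (k + 1) (by omega)]
      congr 1
      omega
  · rintro (rfl | rfl) N
    · exact ⟨k + 2 * N, by omega, key N k hk⟩
    · exact ⟨k + 1 + 2 * N, by omega, key N (k + 1) (by omega)⟩

end Limit

theorem mainTheorem2 (h m : ℕ) (hh : 5 ≤ h) (hm : 2 ≤ m) :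
    (∀ k : ℕ, metamourIter (completeTree h m) k = metamourIter (completeTree h m) (k + 2) ↔
      ⌈Real.logb 2 (h : ℝ)⌉ ≤ (k : ℤ)) ∧
    IsMetamourLimitPeriod (completeTree h m) 2 ∧
    ∀ k : ℕ, ⌈Real.logb 2 (h : ℝ)⌉ ≤ (k : ℤ) →
      metamourLimitSet (completeTree h m) =
        {metamourIter (completeTree h m) k, metamourIter (completeTree h m) (k + 1)} ∧
      (∀ x y : TreeVertex h m, x ≠ y → ¬ IsExceptionalPair x y →
        ((metamourIter (completeTree h m) k).Adj x y ↔
          ∃ d : ℕ, (metamourIter (completeTree h m) 2).edist x y = d ∧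
            ⌈Real.logb 2 (d : ℝ)⌉ ≡ (k : ℤ) [ZMOD 2])) ∧
      (∀ x y : TreeVertex h m, IsExceptionalPair x y →
        ¬ (metamourIter (completeTree h m) k).Adj x y) := by
  simp only [ceil_logb_two_natCast, Nat.cast_le]
  refine ⟨fun k => ⟨fun heq => ?_, metamourIter_eq_add_two hh hm⟩, ⟨⟨two_pos, Nat.clog 2 h, ?_⟩, ?_⟩,
    fun k hk => ⟨metamourLimitSet_completeTree hh hm hk, ?_, ?_⟩⟩
  · by_contra hk
    exact metamourIter_ne_add_two hh hm (not_le.1 hk) heq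
  · intro i hi
    rw [add_comm]
    exact (metamourIter_eq_add_two hh hm hi).symm
  · rintro q ⟨hq, N, hN⟩
    by_contra hq2
    obtain rfl : q = 1 := by omega
    have := hN (max N (Nat.clog 2 h)) (le_max_left _ _)
    rw [add_comm] at this
    exact metamourIter_ne_succ hh hm (le_max_right _ _) this.symm
  · intro x y hne hexc
    rw [metamourIter_adj_iff_of_clog_le hh hm hk]
    have hcast : ∀ n : ℕ, (Nat.clog 2 n : ℤ) ≡ (k : ℤ) [ZMOD 2] ↔ Nat.clog 2 n ≡ k [MOD 2] :=
      fun n => Int.natCast_modEq_iff (n := 2)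
    simp only [hcast]
    constructor
    · rintro ⟨-, n, hn, -, hc⟩
      exact ⟨n, hn, hc⟩
    · rintro ⟨n, hn, hc⟩
      -- The logarithm takes the default value 0 at 0, so the congruence alone does not exclude
      -- distance 0; `x ≠ y` does.
      refine ⟨fun he => hexc he.1, n, hn, ?_, hc⟩
      rintro rfl
      exact hne (eq_of_edist_eq_natCast_zero hn)
  · intro x y hexc hadj
    exact ((metamourIter_adj_iff_of_clog_le hh hm hk x y).1 hadj).1 ⟨hexc, hadj.ne⟩
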